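/- A plane tree is a finite rooted tree in which the children of every vertex are linearly ordered from left to right. A leaf is a vertex without children (by convention, the tree formed by a single vertex has no leaves); a leaf is called old if it is the leftmost child of its parent, and young otherwise. Let $M_m=\sum_{r=0}^{m}\binom{m}{2r}C_r$, where $C_r=\frac{1}{r+1}\binom{2r}{r}$, be the $m$-th Motzkin number. Let $n\ge 1$. There are finitely many plane trees with $n$ edges, each of them has at least one old leaf, and the following hold. 1. For all integers $i\ge1$ and $j\ge0$, the number of plane trees with $n$ edges, $i$ old leaves and $j$ young leaves is $$\frac1n\binom{n}{i}\binom{n-i}{j}\binom{n-i-j}{i-1}.$$ 2. For every integer $k\ge1$, the number of plane trees with $n$ edges and $k$ old leaves is $$\frac{2^{n-2k+1}}{k}\binom{n-1}{2k-2}\binom{2k-2}{k-1}.$$ 3. For every integer $k\ge0$, the number of plane trees with $n$ edges and $k$ young leaves is $$\binom{n-1}{k}M_{n-k-1}.$$ Here the product in part 1 is read as $0$ when $i+j>n$, and the product in part 3 is read as $0$ when $k\ge n$. -/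

import Mathlib

/-- Plane trees: a root together with the ordered (left-to-right, possibly empty) list of the
plane trees that hang from its children. -/
inductive PlaneTree : Type
  | node (children : List PlaneTree) : PlaneTree

namespace PlaneTree

/-- The tree formed by a single vertex, i.e. its root has no children. -/
def isSingle : PlaneTree → Bool
  | node ts => ts.isEmpty

/-- The number of edges: one edge to each child of the root, and the edges of the subtrees. -/
def numEdges : PlaneTree → ℕ
  | node ts => (ts.map fun t => t.numEdges + 1).sum

/-- The number of old leaves, that is, of vertices without children which are the leftmost child
of their parent. The first summand counts those among the children of the root, the second one
those whose parent is another vertex. (The root, having no parent, is never counted; in particular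
the tree formed by a single vertex has no leaves.) -/
def numOldLeaves : PlaneTree → ℕ
  | node ts => (ts.take 1).countP isSingle + (ts.map fun t => t.numOldLeaves).sum

/-- The number of young leaves, that is, of vertices without children which are a child, but not
the leftmost child, of their parent. The first summand counts those among the children of the
root, the second one those whose parent is another vertex. -/
def numYoungLeaves : PlaneTree → ℕ
  | node ts => ts.tail.countP isSingle + (ts.map fun t => t.numYoungLeaves).sum

end PlaneTree

/-- The Motzkin number `M_m = ∑_{r=0}^{m} C(m, 2r) Cat_r`, where `Cat_r` is the Catalan number. -/
def motzkinNumber (m : ℕ) : ℕ :=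
  ∑ r ∈ Finset.range (m + 1), m.choose (2 * r) * catalan r

namespace PlaneTree

open Finset

/-! Cut off the subtree `c` hanging from the rightmost child of the root, leaving `t`. Edges and
leaves of `snoc t c` are those of `t` and `c`, plus one edge and at most one new leaf, according to
which of `t`, `c` is a single vertex. With `z` marking edges and `X` young leaves, the series `Y_i`
of trees with `i` old leaves satisfies `Y_i = z ([i = 1] + (1 + X) Y_i + ∑ Y_a Y_b)`, over `a + b =
i`. Solving the linear part with `u = z / (1 - (1 + X) z)` leaves the Catalan recurrence, so
`Y_{k+1} = Cat_k u^(2k+1)` (`youngSeries_succ`). Its coefficients `Cat_k C(n, 2k) (1 + X)^(n-2k)`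
(`youngPoly_succ_succ`) give all three counts: take a coefficient in `X`, put `X = 1`, or sum over
`k`. -/

/-! ### Cutting at the rightmost child of the root -/

/-- The tree obtained by attaching `c` to the root of `t` as its new rightmost child. -/
def snoc : PlaneTree → PlaneTree → PlaneTree
  | node ts, c => node (ts ++ [c])

theorem snoc_inj {t t' c c' : PlaneTree} : snoc t c = snoc t' c' ↔ t = t' ∧ c = c' := by
  obtain ⟨ts⟩ := t
  obtain ⟨ts'⟩ := t'
  simp [snoc, ← List.concat_eq_append, List.concat_inj]

theorem eq_single_or_snoc (T : PlaneTree) : T = node [] ∨ ∃ t c, T = snoc t c := by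
  obtain ⟨ts⟩ := T
  rcases List.eq_nil_or_concat ts with h | ⟨us, c, h⟩
  · simp [h]
  · exact Or.inr ⟨node us, c, by simp [snoc, h]⟩

@[simp] theorem numEdges_single : numEdges (node []) = 0 := by simp [numEdges]
@[simp] theorem numOldLeaves_single : numOldLeaves (node []) = 0 := by simp [numOldLeaves]
@[simp] theorem numYoungLeaves_single : numYoungLeaves (node []) = 0 := by simp [numYoungLeaves]

theorem numEdges_snoc (t c : PlaneTree) : (snoc t c).numEdges = t.numEdges + c.numEdges + 1 := by
  obtain ⟨ts⟩ := t
  simp [snoc, numEdges, add_assoc]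

theorem numEdges_eq_zero {T : PlaneTree} : T.numEdges = 0 ↔ T = node [] := by
  constructor
  · rcases eq_single_or_snoc T with rfl | ⟨t, c, rfl⟩
    · simp
    · simp [numEdges_snoc]
  · rintro rfl
    simp

theorem isSingle_eq_false {T : PlaneTree} (h : T.numEdges ≠ 0) : T.isSingle = false := by
  obtain ⟨ts⟩ := T
  rcases ts with _ | ⟨u, us⟩
  · simp at h
  · rfl

@[simp] theorem isSingle_single : isSingle (node []) = true := rfl

theorem numOldLeaves_single_snoc (c : PlaneTree) :
    (snoc (node []) c).numOldLeaves = (if c.isSingle then 1 else 0) + c.numOldLeaves := by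
  simp [snoc, numOldLeaves, List.countP_cons]

theorem numYoungLeaves_single_snoc (c : PlaneTree) :
    (snoc (node []) c).numYoungLeaves = c.numYoungLeaves := by
  simp [snoc, numYoungLeaves]

theorem numOldLeaves_snoc {t : PlaneTree} (ht : t.numEdges ≠ 0) (c : PlaneTree) :
    (snoc t c).numOldLeaves = t.numOldLeaves + c.numOldLeaves := by
  obtain ⟨_ | ⟨u, us⟩⟩ := t
  · simp at ht
  · simp [snoc, numOldLeaves, add_assoc]

theorem numYoungLeaves_snoc {t : PlaneTree} (ht : t.numEdges ≠ 0) (c : PlaneTree) :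
    (snoc t c).numYoungLeaves =
      t.numYoungLeaves + c.numYoungLeaves + (if c.isSingle then 1 else 0) := by
  obtain ⟨_ | ⟨u, us⟩⟩ := t
  · simp at ht
  · simp [snoc, numYoungLeaves, List.countP_cons]
    ring

theorem finite_numEdges_eq (n : ℕ) : {T : PlaneTree | T.numEdges = n}.Finite := by
  induction n using Nat.strong_induction_on with
  | _ n ih =>
    have hfin : (⋃ p ∈ (Finset.range n ×ˢ Finset.range n : Finset (ℕ × ℕ)),
        Set.image2 snoc {T | T.numEdges = p.1} {T | T.numEdges = p.2}).Finite := by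
      refine Set.Finite.biUnion (Finset.finite_toSet _) fun p hp => ?_
      rw [Finset.mem_coe, Finset.mem_product, Finset.mem_range, Finset.mem_range] at hp
      exact Set.Finite.image2 _ (ih _ hp.1) (ih _ hp.2)
    refine (hfin.union (Set.finite_singleton (node []))).subset fun T hT => ?_
    rcases eq_single_or_snoc T with rfl | ⟨t, c, rfl⟩
    · simp
    · left
      have hT : (snoc t c).numEdges = n := hT
      rw [numEdges_snoc] at hT
      exact Set.mem_biUnion (x := (t.numEdges, c.numEdges)) (by simp; omega)
        ⟨t, rfl, c, rfl, rfl⟩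

theorem one_le_numOldLeaves {T : PlaneTree} (h : T.numEdges ≠ 0) : 1 ≤ T.numOldLeaves := by
  induction hn : T.numEdges using Nat.strong_induction_on generalizing T with
  | _ n ih =>
    rcases eq_single_or_snoc T with rfl | ⟨t, c, rfl⟩
    · simp at h
    rw [numEdges_snoc] at hn
    by_cases ht : t.numEdges = 0
    · obtain rfl := numEdges_eq_zero.1 ht
      rw [numOldLeaves_single_snoc]
      by_cases hc : c.numEdges = 0
      · simp [numEdges_eq_zero.1 hc]
      · have := ih _ (by omega) hc rfl
        omega
    · have := ih _ (by omega) ht rfl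
      rw [numOldLeaves_snoc ht]
      omega

/-! ### The recursion on finite sets of trees -/

open Classical in
/-- The plane trees with `n ≥ 1` edges and `i` old leaves (none if `n = 0`). -/
noncomputable def trees (n i : ℕ) : Finset PlaneTree :=
  (finite_numEdges_eq n).toFinset.filter fun T => T.numEdges ≠ 0 ∧ T.numOldLeaves = i

theorem mem_trees {n i : ℕ} {T : PlaneTree} :
    T ∈ trees n i ↔ T.numEdges = n ∧ n ≠ 0 ∧ T.numOldLeaves = i := by
  simp only [trees, Finset.mem_filter, Set.Finite.mem_toFinset, Set.mem_ofPred_eq]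
  constructor
  · rintro ⟨rfl, h⟩
    exact ⟨rfl, h⟩
  · rintro ⟨rfl, h⟩
    exact ⟨rfl, h⟩

theorem trees_zero_left (i : ℕ) : trees 0 i = ∅ := by
  ext T
  simp [mem_trees]

theorem trees_zero_right (n : ℕ) : trees n 0 = ∅ := by
  ext T
  simp only [mem_trees, Finset.notMem_empty, iff_false]
  rintro ⟨rfl, h, h'⟩
  have := one_le_numOldLeaves h
  omega

/-- The pairs of trees with at least one edge each, `n` edges and `i` old leaves in total. -/
noncomputable def treePairs (n i : ℕ) : Finset (PlaneTree × PlaneTree) :=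
  open Classical in
  (antidiagonal n ×ˢ antidiagonal i).biUnion fun p => trees p.1.1 p.2.1 ×ˢ trees p.1.2 p.2.2

theorem mem_treePairs {n i : ℕ} {q : PlaneTree × PlaneTree} :
    q ∈ treePairs n i ↔ q.1.numEdges ≠ 0 ∧ q.2.numEdges ≠ 0 ∧
      q.1.numEdges + q.2.numEdges = n ∧ q.1.numOldLeaves + q.2.numOldLeaves = i := by
  simp only [treePairs, Finset.mem_biUnion, Finset.mem_product, HasAntidiagonal.mem_antidiagonal, mem_trees]
  constructor
  · rintro ⟨⟨⟨_, _⟩, _, _⟩, ⟨h1, h2⟩, ⟨rfl, h3, rfl⟩, ⟨rfl, h4, rfl⟩⟩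
    exact ⟨h3, h4, h1, h2⟩
  · rintro ⟨h3, h4, h1, h2⟩
    exact ⟨((_, _), (_, _)), ⟨h1, h2⟩, ⟨rfl, h3, rfl⟩, ⟨rfl, h4, rfl⟩⟩

theorem sum_treePairs {M : Type*} [AddCommMonoid M] (n i : ℕ) (f : PlaneTree × PlaneTree → M) :
    ∑ q ∈ treePairs n i, f q = ∑ a ∈ antidiagonal n, ∑ b ∈ antidiagonal i,
      ∑ q ∈ trees a.1 b.1 ×ˢ trees a.2 b.2, f q := by
  classical
  rw [treePairs, Finset.sum_biUnion, Finset.sum_product]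
  rintro ⟨⟨_, _⟩, _, _⟩ - p' - hne
  rw [Function.onFun, Finset.disjoint_left]
  intro q hq hq'
  simp only [Finset.mem_product, mem_trees] at hq hq'
  apply hne
  obtain ⟨⟨rfl, -, rfl⟩, ⟨rfl, -, rfl⟩⟩ := hq
  ext
  exacts [hq'.1.1, hq'.2.1, hq'.1.2.2, hq'.2.2.2]

-- The four pieces correspond to whether `t` and `c` in `snoc t c` are single vertices. Only when
-- both are does the cut create an old leaf.
open Classical in
theorem trees_succ (n i : ℕ) :
    trees (n + 1) i = ((if n = 0 ∧ i = 1 then {snoc (node []) (node [])} else ∅) ∪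
      (trees n i).image (snoc (node []))) ∪ ((trees n i).image (fun t => snoc t (node [])) ∪
      (treePairs n i).image fun q => snoc q.1 q.2) := by
  ext T
  rcases eq_single_or_snoc T with rfl | ⟨t, c, rfl⟩
  · have h (t c : PlaneTree) : snoc t c ≠ node [] := fun h => by
      simpa [numEdges_snoc] using congrArg numEdges h
    simp only [mem_trees, Finset.mem_union, Finset.mem_image, h]
    split_ifs <;> simp [(h _ _).symm]
  have hleaf : snoc t c ∈ (if n = 0 ∧ i = 1 then {snoc (node []) (node [])} else ∅ :
      Finset PlaneTree) ↔ (n = 0 ∧ i = 1) ∧ t = node [] ∧ c = node [] := by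
    split_ifs with h <;> simp [h, snoc_inj]
  simp only [Finset.mem_union, hleaf, Finset.mem_image, snoc_inj, mem_trees, mem_treePairs,
    numEdges_snoc, Prod.exists]
  by_cases ht : t.numEdges = 0
  · obtain rfl := numEdges_eq_zero.1 ht
    by_cases hc : c.numEdges = 0
    · obtain rfl := numEdges_eq_zero.1 hc
      simp [numOldLeaves_single_snoc]
      grind [numEdges_single]
    · simp [numOldLeaves_single_snoc, isSingle_eq_false hc]
      grind [numEdges_single]
  · by_cases hc : c.numEdges = 0
    · obtain rfl := numEdges_eq_zero.1 hc
      simp [numOldLeaves_snoc ht]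
      grind [numEdges_single]
    · simp [numOldLeaves_snoc ht]
      grind [numEdges_single]

theorem sum_trees_succ {M : Type*} [AddCommMonoid M] (n i : ℕ) (f : PlaneTree → M) :
    ∑ T ∈ trees (n + 1) i, f T =
      (((if n = 0 ∧ i = 1 then f (snoc (node []) (node [])) else 0) +
        ∑ T ∈ trees n i, f (snoc (node []) T)) + (∑ T ∈ trees n i, f (snoc T (node [])) +
        ∑ q ∈ treePairs n i, f (snoc q.1 q.2))) := by
  classical
  rw [trees_succ, Finset.sum_union, Finset.sum_union, Finset.sum_union, Finset.sum_image,
    Finset.sum_image, Finset.sum_image]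
  · congr 2
    split_ifs <;> simp
  · rintro ⟨a, b⟩ - ⟨c, d⟩ - h
    simpa [snoc_inj] using h
  · intro a _ b _ h
    exact (snoc_inj.1 h).1
  · intro a _ b _ h
    exact (snoc_inj.1 h).2
  · rw [Finset.disjoint_left]
    simp only [Finset.mem_image, mem_treePairs, mem_trees, not_exists, not_and]
    rintro _ ⟨t, ht, rfl⟩ q hq h
    obtain ⟨-, h⟩ := snoc_inj.1 h
    simp [h] at hq
  · rw [Finset.disjoint_left]
    simp only [Finset.mem_image, mem_trees, not_exists, not_and]
    rintro _ hT t ht h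
    split_ifs at hT with h0
    · rw [Finset.mem_singleton, ← h, snoc_inj] at hT
      simp [hT.2] at ht
      omega
    · simp at hT
  · rw [Finset.disjoint_left]
    intro T hT hT'
    have h1 : ∃ c, T = snoc (node []) c := by
      simp only [Finset.mem_union, Finset.mem_image] at hT
      rcases hT with hT | ⟨c, -, rfl⟩
      · split_ifs at hT
        · exact ⟨_, Finset.mem_singleton.1 hT⟩
        · simp at hT
      · exact ⟨c, rfl⟩
    obtain ⟨c, rfl⟩ := h1
    simp only [Finset.mem_union, Finset.mem_image, snoc_inj, mem_trees, mem_treePairs] at hT'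
    rcases hT' with ⟨a, h, rfl, -⟩ | ⟨q, h, h', -⟩
    · simp at h
      omega
    · simp [h'] at h

/-! ### Generating functions -/

open Polynomial in
/-- The polynomial counting the trees with `n ≥ 1` edges and `i` old leaves by young leaves. -/
noncomputable def youngPoly (n i : ℕ) : ℤ[X] := ∑ T ∈ trees n i, X ^ T.numYoungLeaves

-- In the factor `1 + X`, the `1` is a nontrivial subtree on an only child, the `X` a young leaf
-- added on the right.
open Polynomial in
theorem youngPoly_succ (n i : ℕ) :
    youngPoly (n + 1) i = (if n = 0 ∧ i = 1 then 1 else 0) + (1 + X) * youngPoly n i +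
      ∑ a ∈ antidiagonal n, ∑ b ∈ antidiagonal i, youngPoly a.1 b.1 * youngPoly a.2 b.2 := by
  have h2 : ∑ T ∈ trees n i, (X : ℤ[X]) ^ (snoc T (node [])).numYoungLeaves =
      X * youngPoly n i := by
    rw [youngPoly, Finset.mul_sum]
    refine Finset.sum_congr rfl fun T hT => ?_
    rw [mem_trees] at hT
    rw [numYoungLeaves_snoc (by omega)]
    simp [pow_succ']
  have h3 : ∑ q ∈ treePairs n i, (X : ℤ[X]) ^ (snoc q.1 q.2).numYoungLeaves =
      ∑ q ∈ treePairs n i, X ^ q.1.numYoungLeaves * X ^ q.2.numYoungLeaves := by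
    refine Finset.sum_congr rfl fun q hq => ?_
    rw [mem_treePairs] at hq
    rw [numYoungLeaves_snoc hq.1, isSingle_eq_false hq.2.1]
    simp [pow_add]
  rw [youngPoly, sum_trees_succ, h2, h3, sum_treePairs]
  simp only [numYoungLeaves_single_snoc, numYoungLeaves_single, pow_zero,
    Finset.sum_product, youngPoly, Finset.sum_mul_sum]
  ring

open Polynomial in
/-- The generating function of the trees with `i` old leaves, by edges and young leaves. -/
noncomputable def youngSeries (i : ℕ) : PowerSeries ℤ[X] := PowerSeries.mk fun n => youngPoly n i

open Polynomial in
theorem youngSeries_eq (i : ℕ) :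
    youngSeries i = PowerSeries.X * ((if i = 1 then 1 else 0) +
      PowerSeries.C (1 + X : ℤ[X]) * youngSeries i +
      ∑ b ∈ antidiagonal i, youngSeries b.1 * youngSeries b.2) := by
  ext1 n
  rcases n with _ | n
  · simp [youngSeries, youngPoly, trees_zero_left]
  · rw [PowerSeries.coeff_succ_X_mul]
    rw [map_add, map_add, PowerSeries.coeff_C_mul]
    simp only [youngSeries, PowerSeries.coeff_mk, map_sum, PowerSeries.coeff_mul, youngPoly_succ]
    rw [Finset.sum_comm]
    congr 2
    by_cases hi : i = 1 <;> simp [hi, PowerSeries.coeff_one]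

open Polynomial in
/-- The power series `z / (1 - (1 + X) z)` in `z`. -/
noncomputable def unarySeries : PowerSeries ℤ[X] :=
  PowerSeries.X * PowerSeries.rescale (1 + X : ℤ[X]) (PowerSeries.mk 1)

open Polynomial in
theorem unarySeries_mul :
    unarySeries * (1 - PowerSeries.X * PowerSeries.C (1 + X : ℤ[X])) = PowerSeries.X := by
  have h := congrArg (PowerSeries.rescale (1 + X : ℤ[X]))
    (PowerSeries.mk_one_mul_one_sub_eq_one ℤ[X])
  rw [map_mul, map_sub, map_one, PowerSeries.rescale_X] at h
  rw [unarySeries, mul_assoc, mul_comm PowerSeries.X (PowerSeries.C _), h, mul_one]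

open Polynomial in
theorem youngSeries_eq_unarySeries_mul (i : ℕ) :
    youngSeries i = unarySeries * ((if i = 1 then 1 else 0) +
      ∑ b ∈ antidiagonal i, youngSeries b.1 * youngSeries b.2) := by
  have hne : (1 - PowerSeries.X * PowerSeries.C (1 + X : ℤ[X])) ≠ 0 := by
    intro h
    have := unarySeries_mul
    rw [h, mul_zero] at this
    exact PowerSeries.X_ne_zero this.symm
  apply mul_left_cancel₀ hne
  have h := youngSeries_eq i
  linear_combination h - ((if i = 1 then 1 else 0) +
      ∑ b ∈ antidiagonal i, youngSeries b.1 * youngSeries b.2) * unarySeries_mul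

theorem youngSeries_zero : youngSeries 0 = 0 := by
  ext1 n
  simp [youngSeries, youngPoly, trees_zero_right]

theorem youngSeries_succ (k : ℕ) :
    youngSeries (k + 1) = catalan k * unarySeries ^ (2 * k + 1) := by
  induction k using Nat.strong_induction_on with
  | _ k ih =>
    -- As `youngSeries 0 = 0`, both ends of the convolution drop out. The rest is the Catalan
    -- recurrence, with exponents `1 + (2a + 1) + (2b + 1) = 2(a + b + 1) + 1`.
    rw [youngSeries_eq_unarySeries_mul, Finset.Nat.antidiagonal_succ, Finset.sum_cons]
    simp only [youngSeries_zero, zero_mul, zero_add, Finset.sum_map]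
    rcases k with _ | k
    · simp [youngSeries_zero]
    · rw [Finset.Nat.antidiagonal_succ', Finset.sum_cons, catalan_succ']
      simp only [Finset.sum_map]
      have h : ∀ x ∈ antidiagonal k, youngSeries (x.1 + 1) * youngSeries (x.2 + 1) =
          (catalan x.1 * catalan x.2 : ℕ) * unarySeries ^ (2 * k + 2) := by
        intro x hx
        rw [HasAntidiagonal.mem_antidiagonal] at hx
        rw [ih _ (by omega), ih _ (by omega), ← hx]
        push_cast
        ring
      simp [youngSeries_zero, Finset.sum_congr rfl h, ← Finset.sum_mul]
      ring

/-! ### Extracting the counts -/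

open Polynomial in
theorem youngPoly_succ_succ (n k : ℕ) :
    youngPoly (n + 1) (k + 1) =
      ((catalan k * n.choose (2 * k) : ℕ) : ℤ[X]) * (1 + X) ^ (n - 2 * k) := by
  have h := congrArg (PowerSeries.coeff (n + 1)) (youngSeries_succ k)
  rw [youngSeries, PowerSeries.coeff_mk, unarySeries, mul_pow, ← map_pow,
    PowerSeries.mk_one_pow_eq_mk_choose_add, ← map_natCast (PowerSeries.C (R := ℤ[X])),
    PowerSeries.coeff_C_mul, PowerSeries.coeff_X_pow_mul'] at h
  rw [h]
  split_ifs with hk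
  · have e : n + 1 - (2 * k + 1) = n - 2 * k := by omega
    rw [e, PowerSeries.coeff_rescale, PowerSeries.coeff_mk, Nat.add_sub_cancel' (by omega)]
    push_cast
    ring
  · rw [Nat.choose_eq_zero_of_lt (by omega)]
    simp

theorem card_trees (n k : ℕ) :
    (trees (n + 1) (k + 1)).card = catalan k * n.choose (2 * k) * 2 ^ (n - 2 * k) := by
  have h := congrArg (Polynomial.eval 1) (youngPoly_succ_succ n k)
  simp only [youngPoly, Polynomial.eval_finsetSum, Polynomial.eval_pow, Polynomial.eval_X, one_pow,
    Finset.sum_const, Polynomial.eval_mul, Polynomial.eval_natCast, Polynomial.eval_add,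
    Polynomial.eval_one, nsmul_eq_mul, mul_one] at h
  norm_num at h
  exact_mod_cast h

theorem card_trees_filter (n k j : ℕ) :
    ((trees (n + 1) (k + 1)).filter fun T => T.numYoungLeaves = j).card =
      catalan k * n.choose (2 * k) * (n - 2 * k).choose j := by
  have h := congrArg (fun p => Polynomial.coeff p j) (youngPoly_succ_succ n k)
  simp only [youngPoly, Polynomial.finsetSum_coeff, Polynomial.coeff_X_pow,
    Polynomial.coeff_natCast_mul, Polynomial.coeff_one_add_X_pow] at h
  rw [Finset.sum_boole] at h
  simp only [eq_comm (a := j)] at h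
  exact_mod_cast h

/-- A crude bound that makes the sum over old leaves in `ncard_young` finite: beyond it the binomial
in `card_trees` vanishes. -/
theorem numOldLeaves_le {T : PlaneTree} {n : ℕ} (h : T.numEdges = n + 1) :
    T.numOldLeaves ≤ n + 1 := by
  have h1 := one_le_numOldLeaves (T := T) (by omega)
  obtain ⟨k, hk⟩ := Nat.exists_eq_add_of_le' h1
  by_contra hlt
  have hmem : T ∈ trees (n + 1) (k + 1) := mem_trees.2 ⟨h, by omega, hk⟩
  have := Finset.card_pos.2 ⟨T, hmem⟩
  rw [card_trees, Nat.choose_eq_zero_of_lt (by omega)] at this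
  simp at this

theorem ncard_old_young (n k j : ℕ) :
    {T : PlaneTree | T.numEdges = n + 1 ∧ T.numOldLeaves = k + 1 ∧ T.numYoungLeaves = j}.ncard =
      catalan k * n.choose (2 * k) * (n - 2 * k).choose j := by
  rw [← card_trees_filter, ← Set.ncard_coe_finset]
  congr 1
  ext T
  simp [mem_trees, and_assoc]

theorem ncard_old (n k : ℕ) :
    {T : PlaneTree | T.numEdges = n + 1 ∧ T.numOldLeaves = k + 1}.ncard =
      catalan k * n.choose (2 * k) * 2 ^ (n - 2 * k) := by
  rw [← card_trees, ← Set.ncard_coe_finset]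
  congr 1
  ext T
  simp [mem_trees]

theorem ncard_young (n j : ℕ) :
    {T : PlaneTree | T.numEdges = n + 1 ∧ T.numYoungLeaves = j}.ncard =
      n.choose j * motzkinNumber (n - j) := by
  classical
  have hset : {T : PlaneTree | T.numEdges = n + 1 ∧ T.numYoungLeaves = j} =
      ((Finset.range (n + 1)).biUnion fun k =>
        (trees (n + 1) (k + 1)).filter fun T => T.numYoungLeaves = j : Finset PlaneTree) := by
    ext T
    simp only [Set.mem_ofPred_eq, Finset.coe_biUnion, Finset.coe_filter, Set.mem_iUnion, mem_trees,
      Finset.coe_range, Set.mem_Iio]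
    constructor
    · rintro ⟨h, hj⟩
      have h1 := one_le_numOldLeaves (T := T) (by omega)
      have h2 := numOldLeaves_le h
      exact ⟨T.numOldLeaves - 1, by omega, ⟨h, by omega, by omega⟩, hj⟩
    · rintro ⟨k, -, ⟨h, -, -⟩, hj⟩
      exact ⟨h, hj⟩
  rw [hset, Set.ncard_coe_finset, Finset.card_biUnion]
  · simp only [card_trees_filter]
    rcases lt_or_ge n j with hj | hj
    · rw [Nat.choose_eq_zero_of_lt hj, zero_mul]
      refine Finset.sum_eq_zero fun k _ => ?_
      rw [Nat.choose_eq_zero_of_lt (by omega : n - 2 * k < j), mul_zero]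
    · rw [motzkinNumber, Finset.mul_sum]
      have hsub : Finset.range (n - j + 1) ⊆ Finset.range (n + 1) := by
        intro r
        simp only [Finset.mem_range]
        omega
      rw [← Finset.sum_subset hsub]
      · refine Finset.sum_congr rfl fun k _ => ?_
        -- Both sides count disjoint pairs of subsets of sizes `2k` and `j` of an `n`-set.
        have h : n.choose (2 * k) * (n - 2 * k).choose j =
            n.choose j * (n - j).choose (2 * k) := by
          rcases lt_or_ge n (2 * k + j) with hlt | hle
          · rw [Nat.choose_eq_zero_of_lt (by omega : n - j < 2 * k), mul_zero]
            rcases lt_or_ge n (2 * k) with h1 | h1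
            · rw [Nat.choose_eq_zero_of_lt h1, zero_mul]
            · rw [Nat.choose_eq_zero_of_lt (by omega : n - 2 * k < j), mul_zero]
          · have h1 := Nat.choose_mul (n := n) (k := 2 * k + j) (s := 2 * k) (by omega)
            have h2 := Nat.choose_mul (n := n) (k := 2 * k + j) (s := j) (by omega)
            rw [Nat.add_sub_cancel_left] at h1
            rw [Nat.add_sub_cancel] at h2
            rw [← h1, ← h2, Nat.choose_symm_add]
        rw [mul_assoc, h]
        ring
      · intro k _ hk
        rw [Finset.mem_range] at hk
        rcases lt_or_ge n (2 * k) with h1 | h1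
        · simp [Nat.choose_eq_zero_of_lt h1]
        · simp [Nat.choose_eq_zero_of_lt (by omega : n - 2 * k < j)]
  · intro k _ l _ hkl
    rw [Function.onFun, Finset.disjoint_left]
    simp only [Finset.mem_filter, mem_trees]
    rintro T ⟨⟨-, -, h⟩, -⟩ ⟨⟨-, -, h'⟩, -⟩
    omega

end PlaneTree

/-! ### Closed forms over the rationals -/

theorem catalan_eq_choose_div (k : ℕ) : (catalan k : ℚ) = ((2 * k).choose k : ℚ) / (k + 1) := by
  rw [eq_div_iff (by positivity), mul_comm]
  exact_mod_cast succ_mul_catalan_eq_centralBinom k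

/-- With `m = n - 2k - j`, both sides are `n! / (k! (k+1)! j! m!)`; if `n < 2k + j`, both vanish. -/
theorem catalan_mul_choose_mul_choose (n k j : ℕ) :
    ((catalan k * n.choose (2 * k) * (n - 2 * k).choose j : ℕ) : ℚ) =
      1 / ((n + 1 : ℕ) : ℚ) * ((n + 1).choose (k + 1) : ℚ) * ((n + 1 - (k + 1)).choose j : ℚ) *
        ((n + 1 - (k + 1) - j).choose k : ℚ) := by
  rcases lt_or_ge n (2 * k + j) with hlt | hle
  · have hl : n.choose (2 * k) * (n - 2 * k).choose j = 0 := by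
      rcases lt_or_ge n (2 * k) with h1 | h1
      · rw [Nat.choose_eq_zero_of_lt h1, zero_mul]
      · rw [Nat.choose_eq_zero_of_lt (by omega : n - 2 * k < j), mul_zero]
    have hr : (n + 1 - (k + 1)).choose j * (n + 1 - (k + 1) - j).choose k = 0 := by
      rcases lt_or_ge (n - k) j with h1 | h1
      · rw [Nat.choose_eq_zero_of_lt (by omega), zero_mul]
      · rw [Nat.choose_eq_zero_of_lt (by omega : n + 1 - (k + 1) - j < k), mul_zero]
    rw [mul_assoc (catalan k), hl, mul_assoc _ (((n + 1 - (k + 1)).choose j : ℕ) : ℚ),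
      ← Nat.cast_mul (((n + 1 - (k + 1)).choose j)), hr]
    simp
  · obtain ⟨m, rfl⟩ := Nat.exists_eq_add_of_le hle
    have e1 : 2 * k + j + m - 2 * k = j + m := by omega
    have e2 : 2 * k + j + m + 1 - (k + 1) = k + j + m := by omega
    have e3 : k + j + m - j = k + m := by omega
    rw [e1, e2, e3]
    push_cast
    rw [catalan_eq_choose_div, Nat.cast_choose ℚ (by omega : k ≤ 2 * k),
      Nat.cast_choose ℚ (by omega : 2 * k ≤ 2 * k + j + m),
      Nat.cast_choose ℚ (by omega : j ≤ j + m),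
      Nat.cast_choose ℚ (by omega : k + 1 ≤ 2 * k + j + m + 1),
      Nat.cast_choose ℚ (by omega : j ≤ k + j + m),
      Nat.cast_choose ℚ (by omega : k ≤ k + m), e1, e2, e3,
      (by omega : 2 * k - k = k), (by omega : j + m - j = m), (by omega : k + m - k = m),
      Nat.factorial_succ k, Nat.factorial_succ (2 * k + j + m)]
    have hf (a : ℕ) : (a.factorial : ℚ) ≠ 0 := by exact_mod_cast a.factorial_ne_zero
    have h1 := hf k
    have h2 := hf (2 * k)
    have h3 := hf (2 * k + j + m)
    have h4 := hf (j + m)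
    have h5 := hf (k + j + m)
    have h6 := hf (k + m)
    have h7 := hf j
    have h8 := hf m
    push_cast
    have h9 : (2 * k + j + m + 1 : ℚ) ≠ 0 := by positivity
    have h10 : (k + 1 : ℚ) ≠ 0 := by positivity
    field_simp

theorem proposition3p2 (n : ℕ) (hn : 1 ≤ n) :
    -- there are finitely many plane trees with `n` edges, so that all the numbers below make sense
    {T : PlaneTree | T.numEdges = n}.Finite ∧
    -- every one of them has an old leaf (the values of the first two formulas at zero old leaves)
    (∀ T : PlaneTree, T.numEdges = n → 1 ≤ T.numOldLeaves) ∧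
    -- the number of plane trees with `n` edges, `i` old leaves and `j` young leaves
    (∀ i j : ℕ, 1 ≤ i →
      ({T : PlaneTree | T.numEdges = n ∧ T.numOldLeaves = i ∧ T.numYoungLeaves = j}.ncard : ℚ) =
        1 / (n : ℚ) * (n.choose i : ℚ) * ((n - i).choose j : ℚ) *
          ((n - i - j).choose (i - 1) : ℚ)) ∧
    -- the number of plane trees with `n` edges and `k` old leaves
    (∀ k : ℕ, 1 ≤ k →
      ({T : PlaneTree | T.numEdges = n ∧ T.numOldLeaves = k}.ncard : ℚ) =
        (2 : ℚ) ^ ((n : ℤ) - 2 * (k : ℤ) + 1) / (k : ℚ) * ((n - 1).choose (2 * k - 2) : ℚ) *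
          ((2 * k - 2).choose (k - 1) : ℚ)) ∧
    -- the number of plane trees with `n` edges and `k` young leaves
    (∀ k : ℕ,
      {T : PlaneTree | T.numEdges = n ∧ T.numYoungLeaves = k}.ncard =
        (n - 1).choose k * motzkinNumber (n - k - 1)) := by
  obtain ⟨n, rfl⟩ := Nat.exists_eq_add_of_le' hn
  refine ⟨PlaneTree.finite_numEdges_eq _, fun T hT => PlaneTree.one_le_numOldLeaves (by omega),
    fun i j hi => ?_, fun k hk => ?_, fun k => ?_⟩
  · obtain ⟨k, rfl⟩ := Nat.exists_eq_add_of_le' hi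
    rw [PlaneTree.ncard_old_young, catalan_mul_choose_mul_choose, Nat.add_sub_cancel]
  · obtain ⟨k, rfl⟩ := Nat.exists_eq_add_of_le' hk
    rw [PlaneTree.ncard_old, Nat.add_sub_cancel, Nat.add_sub_cancel,
      (by omega : 2 * (k + 1) - 2 = 2 * k)]
    rcases lt_or_ge n (2 * k) with h | h
    -- Here the exponent of `2` is negative, but the binomial coefficient is zero.
    · simp [Nat.choose_eq_zero_of_lt h]
    · obtain ⟨m, rfl⟩ := Nat.exists_eq_add_of_le h
      have e : ((2 * k + m + 1 : ℕ) : ℤ) - 2 * ((k + 1 : ℕ) : ℤ) + 1 = (m : ℤ) := by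
        push_cast
        ring
      rw [e, zpow_natCast, Nat.add_sub_cancel_left]
      push_cast
      rw [catalan_eq_choose_div]
      ring
  · rw [PlaneTree.ncard_young, Nat.add_sub_cancel, (by omega : n + 1 - k - 1 = n - k)]
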